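/- There is an absolute constant $C$ such that the following holds. Let $M$ be a graphic or cographic matroid with finite ground set $E$; that is, $M$ or its dual $M^*$ is the matroid whose ground set is the edge set of some finite undirected graph (loops and parallel edges allowed) and in which a set of edges is independent if and only if it contains no cycle. Let $$P(M) := \operatorname{conv}\{\chi(I) : I \subseteq E \text{ independent in } M\} \subseteq \mathbb{R}^E$$ be its independence polytope, where $\chi(I) \in \{0,1\}^E$ is the characteristic vector of $I$. Then $$\operatorname{xc}(P(M)) \le C\,|E|^2 .$$ Here the extension complexity $\operatorname{xc}(P)$ of a polytope $P$ is the smallest number $k$ for which there are a polytope $Q \subseteq \mathbb{R}^d$ (for some $d$), described by $k$ linear inequalities together with any finite number of linear equations, and a linear map $\pi$ with $\pi(Q) = P$. -/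

import Mathlib

open scoped Matrix

noncomputable section

/-- The set `F` of edges of the multigraph `G` contains (the edge set of) a cycle, i.e. there are
`n + 1 ≥ 1` distinct vertices `v 0, …, v n` and distinct edges `e 0, …, e n` in `F` such that
`e i` joins `v i` to `v (i + 1)`, indices being cyclic (`n + 1 = 0` in `Fin (n + 1)`).
For `n = 0` this is a loop, for `n = 1` a pair of parallel edges. -/
def Graph.ContainsCycle {V α : Type*} (G : Graph V α) (F : Set α) : Prop :=
  ∃ (n : ℕ) (v : Fin (n + 1) → V) (e : Fin (n + 1) → α),
    Function.Injective v ∧ Function.Injective e ∧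
      ∀ i, e i ∈ F ∧ G.IsLink (e i) (v i) (v (i + 1))

/-- `M` is the graphic matroid of the multigraph `G`: its ground set is the edge set of `G`, and a
set of edges is independent iff it does not contain a cycle. -/
def Matroid.IsGraphicMatroidOf {V α : Type*} (M : Matroid α) (G : Graph V α) : Prop :=
  M.E = G.edgeSet ∧ ∀ I ⊆ G.edgeSet, M.Indep I ↔ ¬ G.ContainsCycle I

/-- A matroid is graphic if it is the graphic matroid of a graph with finitely many vertices.
(As the vertex set is finite, nothing is lost by taking the vertices in a type in `Type`.) -/
def Matroid.IsGraphic {α : Type*} (M : Matroid α) : Prop :=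
  ∃ (V : Type) (G : Graph V α), G.vertexSet.Finite ∧ M.IsGraphicMatroidOf G

/-- A matroid is cographic if it is the dual of a graphic matroid. -/
def Matroid.IsCographic {α : Type*} (M : Matroid α) : Prop :=
  ∃ N : Matroid α, N.IsGraphic ∧ M = N.dual

/-- The characteristic vector in `ℝ^E` of a subset `I` of `E`. -/
def charVec {α : Type*} (E I : Set α) : E → ℝ :=
  fun e => I.indicator (fun _ => (1 : ℝ)) (e : α)

/-- The independence polytope of `M`, in `ℝ^E` with `E` the ground set: the convex hull of the
characteristic vectors of the independent sets. -/
def Matroid.indepPolytope {α : Type*} (M : Matroid α) : Set (M.E → ℝ) :=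
  convexHull ℝ {x | ∃ I : Set α, M.Indep I ∧ x = charVec M.E I}

/-- The solution set `{y ∈ ℝ^d | A y ≤ b, C y = c}` of `k` linear inequalities and `m` linear
equations. -/
def solutionSet {d k m : ℕ} (A : Matrix (Fin k) (Fin d) ℝ) (b : Fin k → ℝ)
    (C : Matrix (Fin m) (Fin d) ℝ) (c : Fin m → ℝ) : Set (Fin d → ℝ) :=
  {y | A *ᵥ y ≤ b ∧ C *ᵥ y = c}

/-- `P` has an extended formulation with `k` inequalities: there are a polytope `Q` in some `ℝ^d`,
described by `k` linear inequalities and any finite number of linear equations, and a linear map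
`π` with `π(Q) = P`. -/
def HasExtendedFormulation {ι : Type*} (P : Set (ι → ℝ)) (k : ℕ) : Prop :=
  ∃ (d m : ℕ) (A : Matrix (Fin k) (Fin d) ℝ) (b : Fin k → ℝ)
    (C : Matrix (Fin m) (Fin d) ℝ) (c : Fin m → ℝ) (π : (Fin d → ℝ) →ₗ[ℝ] (ι → ℝ)),
    Bornology.IsBounded (solutionSet A b C c) ∧ π '' solutionSet A b C c = P

/-- The extension complexity of `P`: the smallest number of inequalities in any extended
formulation of `P` (and `⊤` if there is none). -/
def extensionComplexity {ι : Type*} (P : Set (ι → ℝ)) : ℕ∞ :=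
  ⨅ (k : ℕ) (_ : HasExtendedFormulation P k), (k : ℕ∞)

end

/-! For graphic `M` this is Martin's formulation. A 0/1 point is a forest exactly when, for every
root `p`, its edges can be directed with indegree at most one everywhere and zero at `p`; the
variables `z` relax these orientations, one for each root. Conversely, given such `z` and a set `S`
with basis `J`, each component of `J` gets a representative, and every edge of `S` is split by the
orientation rooted at its component's representative. Summing indegrees bounds `x(S)` by vertices
minus components, hence by `|J|`, and Edmonds' rank inequalities (`mem_indepPolytopeOn_of_sum_le`)
put `x` in the polytope. Roots and heads are indexed by edge ends, so `8|E|^2` inequalities suffice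
however many vertices there are. For the dual, `x` lies in `P(M✶)` iff `0 ≤ x ≤ 1 - y` for some `y`
in the base polytope of `M` (`indepPolytopeOn_dual`). This costs one further equation and `2|E|`
inequalities. Keeping `E` separate from `M.E` lets `M` and `M✶` share one ambient space. -/

/-- The convex hull, in `ℝ^E`, of the characteristic vectors of the independent sets of `M`. -/
def Matroid.indepPolytopeOn {α : Type*} (M : Matroid α) (E : Set α) : Set (E → ℝ) :=
  convexHull ℝ {x | ∃ I : Set α, M.Indep I ∧ x = charVec E I}

open Classical in
lemma charVec_image {α : Type*} {E : Set α} (J : Finset E) (e : E) :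
    charVec E (Subtype.val '' (J : Set E)) e = if e ∈ J then 1 else 0 := by
  simp [charVec, Set.indicator_apply]

lemma charVec_nonneg {α : Type*} (E I : Set α) : 0 ≤ charVec E I :=
  fun _ => Set.indicator_nonneg (fun _ _ => zero_le_one) _

lemma charVec_le_one {α : Type*} (E I : Set α) : charVec E I ≤ 1 :=
  fun _ => Set.indicator_le_self' (fun _ _ => zero_le_one) _

lemma Set.finite_range_charVec {α : Type*} (E : Set α) [Finite E] :
    (Set.range (charVec E)).Finite := by
  refine ((Set.finite_univ (α := Set E)).image
    (fun J => charVec E (Subtype.val '' J))).subset ?_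
  rintro _ ⟨I, rfl⟩
  refine ⟨Subtype.val ⁻¹' I, trivial, ?_⟩
  ext e
  by_cases he : (e : α) ∈ I <;> simp [charVec, he]

/-! ### Matroid polytopes: greedy algorithm, rank inequalities, duality. -/

namespace Matroid

variable {α : Type*} {M : Matroid α} {E : Set α}

/-- The greedy algorithm, taking elements by decreasing weight. The free bound `t` carries the Abel
summation through the induction; only `t = 0` is used later. -/
lemma exists_isBasis_weighted_sum_le [Fintype E] (hE : M.E = E) (x w : E → ℝ)
    (h : ∀ S J : Finset E, M.IsBasis (Subtype.val '' (J : Set E)) (Subtype.val '' (S : Set E)) →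
      ∑ e ∈ S, x e ≤ J.card) (S : Finset E) :
    ∃ J : Finset E, M.IsBasis (Subtype.val '' (J : Set E)) (Subtype.val '' (S : Set E)) ∧
      ∀ t : ℝ, (∀ e ∈ S, t ≤ w e) →
        ∑ e ∈ S, w e * x e - ∑ e ∈ J, w e ≤ t * (∑ e ∈ S, x e - J.card) := by
  classical
  induction S using Finset.induction_on_min_value w with
  | empty => exact ⟨∅, by simp, by simp⟩
  | insert a S ha hmin ih =>
    obtain ⟨J, hJ, hle⟩ := ih
    have hJS : J ⊆ S := by
      have := hJ.subset
      rwa [Set.image_subset_image_iff Subtype.val_injective, Finset.coe_subset] at this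
    have haJ : a ∉ J := fun h => ha (hJS h)
    -- At `t = w a` the new terms combine exactly; the rank inequality for `insert a S` then allows
    -- lowering `w a` to `t`.
    have h1 := hle (w a) hmin
    by_cases hi : M.Indep (insert (a : α) (Subtype.val '' (J : Set E)))
    · have hb := hJ.insert_isBasis_insert hi
      rw [← Set.image_insert_eq, ← Set.image_insert_eq, ← Finset.coe_insert,
        ← Finset.coe_insert] at hb
      refine ⟨insert a J, hb, fun t ht => ?_⟩
      have h2 := h _ _ hb
      have h3 := ht a (Finset.mem_insert_self _ _)
      rw [Finset.sum_insert ha, Finset.card_insert_of_notMem haJ] at h2 ⊢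
      rw [Finset.sum_insert haJ, Finset.sum_insert ha]
      push_cast at h2 ⊢
      nlinarith
    · have hb : M.IsBasis (Subtype.val '' (J : Set E))
          (Subtype.val '' ((insert a S : Finset E) : Set E)) := by
        rw [Finset.coe_insert, Set.image_insert_eq]
        refine hJ.indep.isBasis_of_forall_insert
          (hJ.subset.trans (Set.subset_insert _ _)) fun e he => ?_
        rcases he with ⟨rfl | he, heJ⟩
        · exact (not_indep_iff (by
            rw [hE]
            rintro _ (rfl | ⟨y, -, rfl⟩)
            exacts [a.2, y.2])).1 hi
        · exact hJ.insert_dep ⟨he, heJ⟩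
      refine ⟨J, hb, fun t ht => ?_⟩
      have h2 := h _ _ hb
      have h3 := ht a (Finset.mem_insert_self _ _)
      rw [Finset.sum_insert ha] at h2 ⊢
      rw [Finset.sum_insert ha]
      nlinarith

/-- Edmonds' description of the independence polytope of a matroid by rank inequalities. -/
theorem mem_indepPolytopeOn_of_sum_le [Fintype E] (hE : M.E = E) {x : E → ℝ} (hx : 0 ≤ x)
    (h : ∀ S J : Finset E, M.IsBasis (Subtype.val '' (J : Set E)) (Subtype.val '' (S : Set E)) →
      ∑ e ∈ S, x e ≤ J.card) : x ∈ M.indepPolytopeOn E := by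
  classical
  by_contra hxP
  have hfin : {x | ∃ I : Set α, M.Indep I ∧ x = charVec E I}.Finite :=
    (Set.finite_range_charVec E).subset (by rintro _ ⟨I, -, rfl⟩; exact ⟨I, rfl⟩)
  obtain ⟨f, u, hf, hu⟩ := geometric_hahn_banach_closed_point (convex_convexHull ℝ _)
    (hfin.isClosed_convexHull ℝ) hxP
  set w : E → ℝ := fun e => f (Pi.single e 1) with hw
  have hfw (y : E → ℝ) : f y = ∑ e, w e * y e := by
    conv_lhs => rw [pi_eq_sum_univ' y]
    simp [hw, map_sum, mul_comm]
  -- Since `x ≥ 0`, discarding negative weights only increases the value at `x`; the greedy basis of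
  -- the rest contradicts separation.
  obtain ⟨J, hJ, hle⟩ := exists_isBasis_weighted_sum_le hE x w h
    (Finset.univ.filter fun e => 0 ≤ w e)
  have h1 := hle 0 (by simp)
  have h2 := hf _ (subset_convexHull ℝ _ ⟨_, hJ.indep, rfl⟩)
  have h3 : ∑ e, w e * x e ≤ ∑ e with 0 ≤ w e, w e * x e := by
    rw [Finset.sum_filter]
    refine Finset.sum_le_sum fun e _ => ?_
    split_ifs with h0
    · exact le_rfl
    · exact mul_nonpos_of_nonpos_of_nonneg (not_le.1 h0).le (hx e)
  rw [hfw] at h2 hu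
  simp only [charVec_image, mul_ite, mul_one, mul_zero, Finset.sum_ite_mem,
    Finset.univ_inter] at h2
  linarith

lemma sum_le_of_mem_indepPolytopeOn [Fintype E] {x : E → ℝ}
    (hx : x ∈ M.indepPolytopeOn E) {S J : Finset E}
    (hJ : M.IsBasis (Subtype.val '' (J : Set E)) (Subtype.val '' (S : Set E))) :
    ∑ e ∈ S, x e ≤ J.card := by
  classical
  have hc : Convex ℝ {x : E → ℝ | ∑ e ∈ S, x e ≤ J.card} :=
    convex_halfSpace_le (f := fun x : E → ℝ => ∑ e ∈ S, x e)
      ⟨fun x y => by simp [Finset.sum_add_distrib], fun c x => by simp [Finset.mul_sum]⟩ _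
  refine convexHull_min ?_ hc hx
  rintro _ ⟨I, hI, rfl⟩
  have h1 : ∑ e ∈ S, charVec E I e = (Finset.filter (fun e : E => (e : α) ∈ I) S).card := by
    simp [charVec, Set.indicator_apply]
  rw [Set.mem_ofPred_eq, h1, Nat.cast_le]
  have hI' : M.Indep (Subtype.val '' (Finset.filter (fun e : E => (e : α) ∈ I) S : Set E)) :=
    hI.subset (by rintro _ ⟨e, he, rfl⟩; exact (Finset.mem_filter.1 he).2)
  obtain ⟨K, hK, hIK⟩ := hI'.subset_isBasis_of_subset
    (Set.image_mono (Finset.coe_subset.2 (Finset.filter_subset _ S))) hJ.subset_ground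
  have := (Set.encard_le_encard hIK).trans_eq (hK.encard_eq_encard hJ)
  rw [Subtype.val_injective.encard_image, Subtype.val_injective.encard_image,
    Set.encard_coe_eq_coe_finsetCard, Set.encard_coe_eq_coe_finsetCard] at this
  exact_mod_cast this

lemma nonneg_of_mem_indepPolytopeOn {x : E → ℝ} (hx : x ∈ M.indepPolytopeOn E) : 0 ≤ x :=
  convexHull_min (by rintro _ ⟨I, -, rfl⟩; exact charVec_nonneg E I) (convex_Ici (0 : E → ℝ)) hx

/-- The independence polytope of the dual, obtained from the base polytope. -/
theorem indepPolytopeOn_dual [Fintype E] (hE : M.E = E) {B₀ : Finset E}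
    (hB₀ : M.IsBase (Subtype.val '' (B₀ : Set E))) :
    M✶.indepPolytopeOn E =
      {x | ∃ y ∈ M.indepPolytopeOn E, ∑ e, y e = B₀.card ∧ 0 ≤ x ∧ x + y ≤ 1} := by
  classical
  have hval (B : Set α) (hB : B ⊆ M.E) :
      ∃ B' : Finset E, Subtype.val '' (B' : Set E) = B :=
    ⟨Finset.univ.filter fun e => (e : α) ∈ B, by
      ext e
      simp only [Finset.coe_filter, Finset.mem_univ, true_and, Set.mem_image, Set.mem_ofPred_eq,
        Subtype.exists, exists_and_left, exists_prop, exists_eq_right_right]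
      exact ⟨fun h => h.1, fun h => ⟨h, hE ▸ hB h⟩⟩⟩
  have hcard (B : Finset E) (hB : M.IsBase (Subtype.val '' (B : Set E))) :
      B.card = B₀.card := by
    have := hB.encard_eq_encard_of_isBase hB₀
    rw [Subtype.val_injective.encard_image, Subtype.val_injective.encard_image,
      Set.encard_coe_eq_coe_finsetCard, Set.encard_coe_eq_coe_finsetCard] at this
    exact_mod_cast this
  apply Set.Subset.antisymm
  · refine convexHull_min ?_ ?_
    · rintro _ ⟨I, hI, rfl⟩
      obtain ⟨-, B, hB, hIB⟩ := dual_indep_iff_exists'.1 hI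
      obtain ⟨B, rfl⟩ := hval B hB.subset_ground
      refine ⟨charVec E (Subtype.val '' (B : Set E)),
        subset_convexHull ℝ _ ⟨_, hB.indep, rfl⟩, ?_, charVec_nonneg _ _, fun e => ?_⟩
      · simp [charVec_image, hcard B hB]
      · by_cases he : (e : α) ∈ I
        · have := Set.disjoint_left.1 hIB he
          simp [charVec, Set.indicator_of_mem he, Set.indicator_of_notMem this]
        · have := charVec_le_one E (Subtype.val '' (B : Set E)) e
          simpa [charVec, Set.indicator_of_notMem he] using this
    · rintro x ⟨y, hy, hys, hx0, hxy⟩ x' ⟨y', hy', hys', hx0', hxy'⟩ a b ha hb hab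
      refine ⟨a • y + b • y', convex_convexHull ℝ _ hy hy' ha hb hab, ?_, ?_, ?_⟩
      · simp only [Pi.add_apply, Pi.smul_apply, smul_eq_mul, Finset.sum_add_distrib,
          ← Finset.mul_sum, hys, hys', ← add_mul, hab, one_mul]
      · exact convex_Ici (0 : E → ℝ) hx0 hx0' ha hb hab
      · have := convex_Iic (1 : E → ℝ) hxy hxy' ha hb hab
        simp only [smul_add, Set.mem_Iic] at this
        rwa [add_add_add_comm] at this
  · rintro x ⟨y, hy, hys, hx0, hxy⟩
    -- With `r` the rank function of `M`: `x(S) ≤ |S| - y(S) = |S| - r(E) + y(Sᶜ) ≤ |S| - r(E) +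
    -- r(Sᶜ)`, which is the dual rank of `S`.
    refine mem_indepPolytopeOn_of_sum_le (M := M✶) hE hx0 fun S J hJ => ?_
    obtain ⟨D, hD, hJD⟩ := hJ.exists_isBase
    obtain ⟨B, hBD⟩ := hval (M.E \ D) Set.sdiff_subset
    have hB : M.IsBase (Subtype.val '' (B : Set E)) := hBD ▸ hD.compl_isBase_of_dual
    have hDB : D = M.E \ Subtype.val '' (B : Set E) := by
      rw [hBD, ← M.dual_ground, Set.sdiff_sdiff_cancel_left hD.subset_ground]
    have hJB : J = S \ B := by
      ext e
      have : (e : α) ∈ Subtype.val '' (J : Set E) ↔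
        (e : α) ∈ D ∩ Subtype.val '' (S : Set E) := by rw [hJD]
      simp only [Set.mem_image, Finset.mem_coe, SetCoe.ext_iff, exists_eq_right, Set.mem_inter_iff,
        hDB, Set.mem_sdiff, hE, e.2, true_and] at this
      rw [this, Finset.mem_sdiff, and_comm]
    have hbas : M.IsBasis (Subtype.val '' ((B \ S : Finset E) : Set E))
        (Subtype.val '' ((Sᶜ : Finset E) : Set E)) := by
      have h1 := (hB.inter_isBasis_iff_compl_inter_isBasis_dual (X := M.E \ Subtype.val '' (S : Set E))
        Set.sdiff_subset).2 (by
          rw [← hDB, Set.sdiff_sdiff_cancel_left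
            (show Subtype.val '' (S : Set E) ⊆ M.E from hJ.subset_ground), ← hJD]
          exact hJ)
      convert h1 using 1
      · ext e
        simp only [Finset.coe_sdiff, Set.mem_image, Set.mem_sdiff, Set.mem_inter_iff, hE,
          Finset.mem_coe, Subtype.exists, exists_and_right, exists_eq_right]
        constructor
        · rintro ⟨h, h1, h2⟩; exact ⟨⟨h, h1⟩, h, fun ⟨_, h3⟩ => h2 h3⟩
        · rintro ⟨⟨h, h1⟩, _, h2⟩; exact ⟨h, h1, fun h3 => h2 ⟨h, h3⟩⟩
      · ext e
        simp only [Finset.coe_compl, Set.mem_image, Set.mem_compl_iff, Set.mem_sdiff, hE,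
          Finset.mem_coe, Subtype.exists, exists_and_right, exists_eq_right]
        constructor
        · rintro ⟨h, h2⟩; exact ⟨h, fun ⟨_, h3⟩ => h2 h3⟩
        · rintro ⟨h, h2⟩; exact ⟨h, fun h3 => h2 ⟨h, h3⟩⟩
    have h1 := sum_le_of_mem_indepPolytopeOn hy hbas
    have h2 := Finset.sum_add_sum_compl S y
    have h3 : ∑ e ∈ S, x e + ∑ e ∈ S, y e ≤ S.card := by
      rw [← Finset.sum_add_distrib]
      simpa using Finset.sum_le_sum (s := S) fun e _ => hxy e
    have h4 : (J.card : ℝ) + B.card = S.card + (B \ S).card := by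
      rw [hJB]
      have := Finset.card_sdiff_add_card_inter S B
      have h5 := Finset.card_sdiff_add_card_inter B S
      rw [Finset.inter_comm] at h5
      norm_cast
      omega
    rw [hcard B hB] at h4
    linarith

end Matroid

/-! ### Constructing extended formulations. -/

lemma HasExtendedFormulation.of_fintype {ι σ κ μ : Type*} [Fintype σ] [Fintype κ] [Fintype μ]
    {P : Set (ι → ℝ)} (f : κ → (σ → ℝ) →ₗ[ℝ] ℝ) (b : κ → ℝ) (g : μ → (σ → ℝ) →ₗ[ℝ] ℝ)
    (c : μ → ℝ) (π : (σ → ℝ) →ₗ[ℝ] (ι → ℝ)) {r : ℝ}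
    (hr : ∀ y : σ → ℝ, (∀ k, f k y ≤ b k) → (∀ j, g j y = c j) → ∀ i, |y i| ≤ r)
    (hP : π '' {y | (∀ k, f k y ≤ b k) ∧ ∀ j, g j y = c j} = P) :
    HasExtendedFormulation P (Fintype.card κ) := by
  let eσ := Fintype.equivFin σ
  let eκ := Fintype.equivFin κ
  let eμ := Fintype.equivFin μ
  let L : (Fin (Fintype.card σ) → ℝ) →ₗ[ℝ] (σ → ℝ) := LinearMap.funLeft ℝ ℝ eσ
  let F := LinearMap.pi fun k => f (eκ.symm k) ∘ₗ L
  let H := LinearMap.pi fun j => g (eμ.symm j) ∘ₗ L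
  have hsol : solutionSet (LinearMap.toMatrix' F) (b ∘ eκ.symm) (LinearMap.toMatrix' H)
      (c ∘ eμ.symm) = {y | (∀ k, f k (L y) ≤ b k) ∧ ∀ j, g j (L y) = c j} := by
    ext y
    simp only [solutionSet, LinearMap.toMatrix'_mulVec, Set.mem_ofPred_eq, Pi.le_def, funext_iff]
    refine and_congr ?_ ?_
    · exact ⟨fun h k => by simpa [F] using h (eκ k), fun h k => h _⟩
    · exact ⟨fun h k => by simpa [H] using h (eμ k), fun h k => h _⟩
  refine ⟨_, _, LinearMap.toMatrix' F, b ∘ eκ.symm, LinearMap.toMatrix' H, c ∘ eμ.symm,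
    π ∘ₗ L, ?_, ?_⟩
  · rw [hsol]
    refine (Metric.isBounded_Icc (fun _ => -r) (fun _ => r)).subset fun y hy => ?_
    have h (i) : |y i| ≤ r := by simpa [L, LinearMap.funLeft] using hr _ hy.1 hy.2 (eσ.symm i)
    exact ⟨fun i => (abs_le.1 (h i)).1, fun i => (abs_le.1 (h i)).2⟩
  · rw [hsol, ← hP, LinearMap.coe_comp, Set.image_comp]
    congr 1
    ext y
    constructor
    · rintro ⟨y, hy, rfl⟩
      exact hy
    · intro hy
      have hLy : L (y ∘ eσ.symm) = y := by ext; simp [L, LinearMap.funLeft]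
      exact ⟨y ∘ eσ.symm, by simpa only [Set.mem_ofPred_eq, hLy] using hy, hLy⟩

lemma HasExtendedFormulation.extensionComplexity_le {ι : Type*} {P : Set (ι → ℝ)} {k : ℕ}
    (h : HasExtendedFormulation P k) : extensionComplexity P ≤ k :=
  iInf₂_le k h

/-- An extended formulation of the set of the vectors between `0` and `1 - y`, where `y` runs
through the points of `P` with coordinate sum `t`. -/
lemma HasExtendedFormulation.below_complement {ι : Type*} [Fintype ι] {P : Set (ι → ℝ)} {k : ℕ}
    (h : HasExtendedFormulation P k) (hP : ∀ y ∈ P, 0 ≤ y) (t : ℝ) :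
    HasExtendedFormulation {x : ι → ℝ | ∃ y ∈ P, ∑ i, y i = t ∧ 0 ≤ x ∧ x + y ≤ 1}
      (k + (Fintype.card ι + Fintype.card ι)) := by
  obtain ⟨d, m, A, b, C, c, π, hbd, rfl⟩ := h
  let L : (Fin d ⊕ ι → ℝ) →ₗ[ℝ] (Fin d → ℝ) := LinearMap.funLeft ℝ ℝ Sum.inl
  let X : (Fin d ⊕ ι → ℝ) →ₗ[ℝ] (ι → ℝ) := LinearMap.funLeft ℝ ℝ Sum.inr
  obtain ⟨r, hr⟩ := hbd.subset_closedBall 0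
  have key := HasExtendedFormulation.of_fintype (σ := Fin d ⊕ ι) (κ := Fin k ⊕ (ι ⊕ ι))
    (μ := Fin m ⊕ Unit)
    (P := {x : ι → ℝ | ∃ y ∈ π '' solutionSet A b C c, ∑ i, y i = t ∧ 0 ≤ x ∧ x + y ≤ 1})
    (Sum.elim (fun i => LinearMap.proj i ∘ₗ A.mulVecLin ∘ₗ L)
      (Sum.elim (fun i => -(LinearMap.proj i ∘ₗ X))
        (fun i => LinearMap.proj i ∘ₗ (X + π ∘ₗ L))))
    (Sum.elim b (Sum.elim 0 1))
    (Sum.elim (fun i => LinearMap.proj i ∘ₗ C.mulVecLin ∘ₗ L)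
      (fun _ => ∑ i, LinearMap.proj i ∘ₗ π ∘ₗ L))
    (Sum.elim c (fun _ => t)) X (r := max r 1) ?_ ?_
  · simpa using key
  · intro y hf hg
    simp only [Sum.forall, Sum.elim_inl, Sum.elim_inr, LinearMap.comp_apply, LinearMap.proj_apply,
      Matrix.mulVecLin_apply, LinearMap.neg_apply, LinearMap.add_apply, Pi.add_apply,
      Pi.zero_apply, Pi.one_apply] at hf hg
    have hmem : L y ∈ solutionSet A b C c := ⟨hf.1, funext hg.1⟩
    rintro (i | i)
    · have h1 := hr hmem
      rw [mem_closedBall_zero_iff] at h1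
      exact ((norm_le_pi_norm (L y) i).trans h1).trans (le_max_left _ _)
    · have h1 := hP _ ⟨_, hmem, rfl⟩ i
      have h2 := hf.2.1 i
      have h3 := hf.2.2 i
      refine le_trans (abs_le.2 ⟨?_, ?_⟩) (le_max_right _ _)
      · change -(y (Sum.inr i)) ≤ 0 at h2
        linarith
      · change y (Sum.inr i) + _ ≤ 1 at h3
        simp only [Pi.zero_apply] at h1
        linarith
  · ext x
    simp only [Sum.forall, Sum.elim_inl, Sum.elim_inr, LinearMap.comp_apply, LinearMap.proj_apply,
      Matrix.mulVecLin_apply, LinearMap.neg_apply, LinearMap.add_apply, Pi.add_apply,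
      Pi.zero_apply, Pi.one_apply, LinearMap.sum_apply]
    constructor
    · rintro ⟨y, ⟨hf, hg⟩, rfl⟩
      exact ⟨_, ⟨_, ⟨hf.1, funext hg.1⟩, rfl⟩, hg.2 (), fun i => neg_nonpos.1 (hf.2.1 i), hf.2.2⟩
    · rintro ⟨_, ⟨y, hy, rfl⟩, ht, h0, h1⟩
      exact ⟨Sum.elim y x, ⟨⟨hy.1, fun i => neg_nonpos.2 (h0 i), h1⟩,
        fun i => congrFun hy.2 i, fun _ => ht⟩, rfl⟩

/-! ### Cycles, forests and components of multigraphs. -/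

namespace Graph

variable {V α : Type*} {G : Graph V α}

lemma ContainsCycle.mono {F F' : Set α} (h : G.ContainsCycle F) (hF : F ⊆ F') :
    G.ContainsCycle F' :=
  let ⟨n, v, e, hv, he, h⟩ := h
  ⟨n, v, e, hv, he, fun i => ⟨hF (h i).1, (h i).2⟩⟩

/-- The simple graph in which two vertices are adjacent if some edge in `F` joins them. -/
def simpleOf (G : Graph V α) (F : Set α) : SimpleGraph V :=
  SimpleGraph.fromRel fun u v => ∃ e ∈ F, G.IsLink e u v

lemma exists_isLink_of_adj_simpleOf {F : Set α} {u v : V} (h : (G.simpleOf F).Adj u v) :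
    ∃ e ∈ F, G.IsLink e u v := by
  rcases h.2 with h | ⟨e, he, h⟩
  exacts [h, ⟨e, he, h.symm⟩]

lemma IsLink.reachable_simpleOf {F : Set α} {e : α} {u v : V} (h : G.IsLink e u v) (he : e ∈ F) :
    (G.simpleOf F).Reachable u v := by
  by_cases huv : u = v
  · rw [huv]
  · exact SimpleGraph.Adj.reachable ⟨huv, .inl ⟨e, he, h⟩⟩

lemma simpleOf_mono {F F' : Set α} (h : F ⊆ F') : G.simpleOf F ≤ G.simpleOf F' := by
  rintro u v ⟨hne, ⟨e, he, hl⟩ | ⟨e, he, hl⟩⟩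
  exacts [⟨hne, .inl ⟨e, h he, hl⟩⟩, ⟨hne, .inr ⟨e, h he, hl⟩⟩]

/-- A path from `u` to `v` in `F` is closed up by `e`, placed at the last index; a loop is the path
of length zero. -/
lemma IsLink.containsCycle_insert {F : Set α} {e : α} {u v : V} (h : G.IsLink e u v)
    (he : e ∉ F) (hr : (G.simpleOf F).Reachable u v) : G.ContainsCycle (insert e F) := by
  classical
  obtain ⟨p, hp⟩ := hr.exists_isPath
  have hstep (i : ℕ) (hi : i < p.length) :
      ∃ f ∈ F, G.IsLink f (p.getVert i) (p.getVert (i + 1)) :=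
    exists_isLink_of_adj_simpleOf (p.adj_getVert_succ hi)
  choose f hfF hf using hstep
  have hinj {i j : ℕ} (hi : i ≤ p.length) (hj : j ≤ p.length) (hij : p.getVert i = p.getVert j) :
      i = j := hp.getVert_injOn hi hj hij
  refine ⟨p.length, fun i => p.getVert i, fun i => if hi : (i : ℕ) < p.length then f i hi else e,
    fun i j hij => Fin.ext (hinj (by omega) (by omega) hij), fun i j hij => ?_, fun i => ?_⟩
  · dsimp only at hij
    ext
    split_ifs at hij with hi hj hj
    · rcases (hf i hi).eq_and_eq_or_eq_and_eq (hij ▸ hf j hj) with ⟨h1, -⟩ | ⟨h1, h2⟩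
      · exact hinj (by omega) (by omega) h1
      · have := hinj (by omega) (by omega) h1
        have := hinj (by omega) (by omega) h2
        omega
    · exact (he (hij ▸ hfF _ _)).elim
    · exact (he (hij ▸ hfF _ _)).elim
    · omega
  · dsimp only
    split_ifs with hi
    · have hval : ((i + 1 : Fin (p.length + 1)) : ℕ) = i + 1 := by
        rw [Fin.val_add_one_of_lt]
        exact Fin.lt_def.2 (by simpa using hi)
      rw [hval]
      exact ⟨Set.mem_insert_of_mem _ (hfF _ _), hf _ _⟩
    · obtain rfl : i = Fin.last _ := Fin.ext (by simp; omega)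
      simpa using h.symm

open Fin.CommRing in
-- The cycle must use `e`, and the rest of it joins the ends of `e` inside `F`, where `ρ` is
-- constant along edges.
lemma ContainsCycle.eq_of_insert {β : Type*} {F : Set α} {e : α} {u v : V}
    (hc : G.ContainsCycle (insert e F)) (hF : ¬ G.ContainsCycle F) {ρ : V → β}
    (hρ : ∀ f ∈ F, ∀ x y, G.IsLink f x y → ρ x = ρ y) (h : G.IsLink e u v) : ρ u = ρ v := by
  obtain ⟨n, w, f, hw, hf, hlink⟩ := hc
  obtain ⟨i, hi⟩ : ∃ i, f i = e := by
    by_contra! hne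
    exact hF ⟨n, w, f, hw, hf, fun i => ⟨(hlink i).1.resolve_left (hne i), (hlink i).2⟩⟩
  have hstep (j) (hj : j ≠ i) : ρ (w j) = ρ (w (j + 1)) :=
    hρ (f j) ((hlink j).1.resolve_left fun h => hj (hf (h.trans hi.symm))) _ _ (hlink j).2
  have hwalk (k : ℕ) (hk : k ≤ n) : ρ (w (i + 1)) = ρ (w (i + 1 + (k : Fin (n + 1)))) := by
    induction k with
    | zero => simp
    | succ k ih =>
      rw [ih (by omega), hstep]
      · push_cast
        rw [add_assoc (i + 1)]
      · intro h
        have h0 : ((k + 1 : ℕ) : Fin (n + 1)) = 0 := by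
          push_cast
          rw [add_assoc, add_eq_left] at h
          exact (add_comm _ _).trans h
        rw [Fin.natCast_eq_zero] at h0
        exact absurd (Nat.le_of_dvd (by omega) h0) (by omega)
  have hlast := hwalk n le_rfl
  have h0 : i + 1 + (n : Fin (n + 1)) = i := by
    have : ((n + 1 : ℕ) : Fin (n + 1)) = 0 := Fin.natCast_self _
    push_cast at this
    rw [add_assoc, add_comm 1, this, add_zero]
  rw [h0] at hlast
  have hl := (hlink i).2
  rw [hi] at hl
  rcases h.eq_and_eq_or_eq_and_eq hl with ⟨rfl, rfl⟩ | ⟨rfl, rfl⟩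
  exacts [hlast.symm, hlast]

/-- The edges of a forest can be directed such that no vertex has indegree more than one and the
vertices in `R` have indegree zero, if no two of them are connected in the forest. -/
lemma exists_injOn_inc_of_not_containsCycle [Nonempty V] {I : Finset α} (hI : (I : Set α) ⊆ G.edgeSet)
    (hc : ¬ G.ContainsCycle (I : Set α)) {R : Set V}
    (hR : R.Pairwise fun a b => ¬ (G.simpleOf I).Reachable a b) :
    ∃ h : α → V, (∀ e ∈ I, G.Inc e (h e)) ∧ Set.InjOn h I ∧ ∀ e ∈ I, h e ∉ R := by
  classical
  induction I using Finset.induction_on generalizing R with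
  | empty =>
    exact ⟨fun _ => Classical.arbitrary V, by simp⟩
  | insert e I he ih =>
    rw [Finset.coe_insert] at hc hI hR
    have hle {a b : V} : (G.simpleOf (I : Set α)).Reachable a b →
        (G.simpleOf (insert e (I : Set α))).Reachable a b :=
      SimpleGraph.Reachable.mono (G.simpleOf_mono (Set.subset_insert _ _))
    obtain ⟨u, v, huv⟩ := G.exists_isLink_of_mem_edgeSet (hI (Set.mem_insert e _))
    have hne : ¬ (G.simpleOf (I : Set α)).Reachable u v :=
      fun h => hc (huv.containsCycle_insert he h)
    -- Direct `e` towards `w` and forbid `w` as a head for the other edges. This is why the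
    -- induction needs a set `R` rather than a single root.
    have key (w : V) (hw : G.Inc e w) (hRw : ∀ a ∈ R, ¬ (G.simpleOf (I : Set α)).Reachable a w) :
        ∃ h : α → V, (∀ f ∈ insert e I, G.Inc f (h f)) ∧ Set.InjOn h (insert e I : Finset α) ∧
          ∀ f ∈ insert e I, h f ∉ R := by
      obtain ⟨h, h1, h2, h3⟩ := ih ((Set.subset_insert _ _).trans hI)
        (fun h => hc (h.mono (Set.subset_insert _ _))) (R := insert w R) (by
          refine Set.Pairwise.insert (fun a ha b hb hab h => hR ha hb hab (hle h))
            fun a ha _ => ⟨fun h => hRw a ha h.symm, hRw a ha⟩)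
      have hne' {f : α} (hf : f ∈ I) : f ≠ e := fun h => he (h ▸ hf)
      refine ⟨Function.update h e w, fun f hf => ?_, ?_, fun f hf => ?_⟩
      · rcases Finset.mem_insert.1 hf with rfl | hf
        · simpa using hw
        · simpa [hne' hf] using h1 f hf
      · rw [Finset.coe_insert, Set.injOn_insert (by simpa using he)]
        refine ⟨fun f hf g hg hfg => h2 hf hg ?_, ?_⟩
        · simpa [hne' hf, hne' hg] using hfg
        · rintro ⟨f, hf, hfe⟩
          rw [Function.update_self, Function.update_of_ne (hne' hf)] at hfe
          exact h3 f hf (hfe ▸ Set.mem_insert _ _)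
      · rcases Finset.mem_insert.1 hf with rfl | hf
        · rw [Function.update_self]
          exact fun hwR => hRw w hwR (SimpleGraph.Reachable.refl _)
        · rw [Function.update_of_ne (hne' hf)]
          exact fun h => h3 f hf (Set.mem_insert_of_mem _ h)
    -- At most one end of `e` is connected to `R` in `I`, otherwise `e` would join two members of
    -- `R` or close a cycle.
    by_cases hv : ∃ b ∈ R, (G.simpleOf (I : Set α)).Reachable b v
    · obtain ⟨b, hb, hbv⟩ := hv
      refine key u ⟨v, huv⟩ fun a ha hau => ?_
      by_cases hab : a = b
      · exact hne (hau.symm.trans (hab ▸ hbv))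
      · exact hR ha hb hab (((hle hau).trans
          (huv.reachable_simpleOf (Set.mem_insert _ _))).trans (hle hbv).symm)
    · push Not at hv
      exact key v ⟨u, huv.symm⟩ hv

/-- Every edge set `J` on the vertex set `W` has at least `|W| - |J|` connected components. -/
lemma exists_componentMap [DecidableEq V] (W : Finset V) (J : Finset α)
    (hW : ∀ e ∈ J, ∀ u v, G.IsLink e u v → u ∈ W) :
    ∃ ρ : V → V, (∀ v ∈ W, ρ v ∈ W) ∧ (∀ e ∈ J, ∀ u v, G.IsLink e u v → ρ u = ρ v) ∧
      W.card ≤ J.card + (W.filter fun v => v = ρ v).card := by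
  classical
  induction J using Finset.induction_on with
  | empty => exact ⟨id, by simp⟩
  | insert e J he ih =>
    obtain ⟨ρ, h1, h2, h3⟩ := ih fun f hf => hW f (Finset.mem_insert_of_mem hf)
    rw [Finset.card_insert_of_notMem he]
    by_cases hx : ∃ u v, G.IsLink e u v
    · obtain ⟨u, v, huv⟩ := hx
      have hv := hW e (Finset.mem_insert_self _ _) _ _ huv.symm
      refine ⟨fun w => if ρ w = ρ u then ρ v else ρ w, fun w hw => ?_, fun f hf x y hxy => ?_, ?_⟩
      · dsimp only
        split_ifs
        exacts [h1 _ hv, h1 _ hw]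
      · rcases Finset.mem_insert.1 hf with rfl | hf
        · rcases hxy.eq_and_eq_or_eq_and_eq huv with ⟨rfl, rfl⟩ | ⟨rfl, rfl⟩ <;> simp
        · simp only [h2 f hf x y hxy]
      · have hsub : (W.filter fun w => w = ρ w) ⊆
            insert (ρ u) (W.filter fun w => w = if ρ w = ρ u then ρ v else ρ w) := by
          intro w hw
          rw [Finset.mem_filter] at hw
          rw [Finset.mem_insert, Finset.mem_filter]
          by_cases hwu : ρ w = ρ u
          · exact .inl (hw.2.trans hwu)
          · exact .inr ⟨hw.1, by rw [if_neg hwu]; exact hw.2⟩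
        have := (Finset.card_le_card hsub).trans (Finset.card_insert_le _ _)
        dsimp only
        omega
    · push Not at hx
      refine ⟨ρ, h1, fun f hf x y hxy => ?_, by omega⟩
      rcases Finset.mem_insert.1 hf with rfl | hf
      exacts [(hx _ _ hxy).elim, h2 f hf x y hxy]

end Graph

/-! ### Martin's formulation. -/

namespace Graph

variable {V α : Type*} {G : Graph V α} {M : Matroid α} {E : Set α}

open Classical in
/-- Martin's description of the independence polytope of a graphic matroid. The ends of the edge
`e` are `s (e, false)` and `s (e, true)`. For each root `s p`, the numbers `z p (e, b)` split `x e`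
between the two directions of `e`, with `(e, b)` being directed towards `s (e, b)`. -/
theorem mem_indepPolytopeOn_iff [Fintype E] (hME : M.E = E) (hM : M.IsGraphicMatroidOf G)
    {s : E × Bool → V} (hs : ∀ e : E, G.IsLink (e : α) (s (e, false)) (s (e, true))) {x : E → ℝ} :
    x ∈ M.indepPolytopeOn E ↔ ∃ z : (E × Bool) × (E × Bool) → ℝ, (∀ a, 0 ≤ z a) ∧
      (∀ p q, ∑ a with s a = s q, z (p, a) ≤ if s q = s p then 0 else 1) ∧
      ∀ p e, x e = z (p, (e, false)) + z (p, (e, true)) := by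
  have hinc {e : E} {v : V} : G.Inc e v ↔ ∃ b, v = s (e, b) := by
    constructor
    · rintro ⟨w, hw⟩
      rcases hw.left_eq_or_eq (hs e) with h | h
      exacts [⟨_, h⟩, ⟨_, h⟩]
    · rintro ⟨_ | _, rfl⟩
      exacts [⟨_, hs e⟩, ⟨_, (hs e).symm⟩]
  constructor
  · refine fun hx => convexHull_min (t := {x : E → ℝ | ∃ z : (E × Bool) × (E × Bool) → ℝ,
      (∀ a, 0 ≤ z a) ∧
      (∀ p q, ∑ a with s a = s q, z (p, a) ≤ if s q = s p then 0 else 1) ∧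
      ∀ p e, x e = z (p, (e, false)) + z (p, (e, true))}) ?_ ?_ hx
    · rintro _ ⟨I, hI, rfl⟩
      have hfin : I.Finite := by
        have : M.E.Finite := hME ▸ Set.toFinite E
        exact this.subset hI.subset_ground
      lift I to Finset α using hfin
      have hIE : (I : Set α) ⊆ G.edgeSet := hM.1 ▸ hI.subset_ground
      have hacyc := (hM.2 _ hIE).1 hI
      have hroot (p : E × Bool) : ∃ h : α → V, (∀ e ∈ I, G.Inc e (h e)) ∧ Set.InjOn h I ∧
          ∀ e ∈ I, h e ∉ ({s p} : Set V) :=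
        haveI : Nonempty V := ⟨s p⟩
        exists_injOn_inc_of_not_containsCycle hIE hacyc (Set.pairwise_singleton _ _)
      choose h h1 h2 h3 using hroot
      have hex (p : E × Bool) (e : E) : ∃ b : Bool, (e : α) ∈ I → h p e = s (e, b) := by
        by_cases he : (e : α) ∈ I
        · exact (hinc.1 (h1 p e he)).imp fun b hb _ => hb
        · exact ⟨true, fun h => (he h).elim⟩
      choose d hd using hex
      -- The 0/1 indicator of the orientation of the forest `I` rooted at `s p`.
      refine ⟨fun a => if (a.2.1 : α) ∈ I ∧ d a.1 a.2.1 = a.2.2 then 1 else 0, fun a => ?_,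
        fun p q => ?_, fun p e => ?_⟩
      · dsimp only
        split_ifs <;> norm_num
      · rw [Finset.sum_boole, Finset.filter_filter]
        have hmem {a : E × Bool} (ha : s a = s q ∧ (a.1 : α) ∈ I ∧ d p a.1 = a.2) :
            h p a.1 = s q := by
          rw [hd p a.1 ha.2.1, ha.2.2, ← ha.1]
        split_ifs with hqp
        · rw [Finset.filter_eq_empty_iff.2]
          · simp
          · exact fun a _ ha => h3 p a.1 ha.2.1 ((hmem ha).trans hqp)
        · have : (Finset.univ.filter fun a : E × Bool =>
              s a = s q ∧ (a.1 : α) ∈ I ∧ d p a.1 = a.2).card ≤ 1 := by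
            rw [Finset.card_le_one]
            intro a ha a' ha'
            rw [Finset.mem_filter] at ha ha'
            have h4 : a.1 = a'.1 := Subtype.ext
              (h2 p ha.2.2.1 ha'.2.2.1 ((hmem ha.2).trans (hmem ha'.2).symm))
            exact Prod.ext h4 (by rw [← ha.2.2.2, ← ha'.2.2.2, h4])
          exact_mod_cast this
      · by_cases he : (e : α) ∈ I
        · cases hde : d p e <;> simp [charVec, he, hde]
        · simp [charVec, he]
    · rintro x ⟨z, h0, h1, h2⟩ y ⟨z', h0', h1', h2'⟩ a b ha hb hab
      refine ⟨a • z + b • z', fun c => ?_, fun p q => ?_, fun p e => ?_⟩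
      · exact add_nonneg (mul_nonneg ha (h0 c)) (mul_nonneg hb (h0' c))
      · simp only [Pi.add_apply, Pi.smul_apply, smul_eq_mul, Finset.sum_add_distrib,
          ← Finset.mul_sum]
        calc _ ≤ a * (if s q = s p then (0 : ℝ) else 1) + b * (if s q = s p then 0 else 1) :=
              add_le_add (mul_le_mul_of_nonneg_left (h1 p q) ha)
                (mul_le_mul_of_nonneg_left (h1' p q) hb)
          _ = _ := by rw [← add_mul, hab, one_mul]
      · simp only [Pi.add_apply, Pi.smul_apply, smul_eq_mul, h2 p e, h2' p e]
        ring
  · rintro ⟨z, h0, h1, h2⟩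
    have hx0 : 0 ≤ x := fun e => by
      rw [h2 (e, true) e]
      exact add_nonneg (h0 _) (h0 _)
    refine Matroid.mem_indepPolytopeOn_of_sum_le hME hx0 fun S J hJ => ?_
    have hJG : Subtype.val '' (J : Set E) ⊆ G.edgeSet := hM.1 ▸ hJ.indep.subset_ground
    let W : Finset V := Finset.univ.image s
    have hsW (a : E × Bool) : s a ∈ W := Finset.mem_image_of_mem _ (Finset.mem_univ _)
    obtain ⟨ρ, hρW, hρJ, hcard⟩ := exists_componentMap (G := G) W
      (J.map (Function.Embedding.subtype _)) (by
        intro e he u v huv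
        obtain ⟨e, -, rfl⟩ := Finset.mem_map.1 he
        obtain ⟨b, rfl⟩ := hinc.1 ⟨v, huv⟩
        exact hsW _)
    have hρJ' : ∀ f ∈ Subtype.val '' (J : Set E), ∀ u v, G.IsLink f u v → ρ u = ρ v := by
      rintro _ ⟨f, hf, rfl⟩
      exact hρJ _ (Finset.mem_map_of_mem _ hf)
    have hρS (e) (he : e ∈ S) : ρ (s (e, false)) = ρ (s (e, true)) := by
      by_cases heJ : e ∈ J
      · exact hρJ' _ ⟨e, heJ, rfl⟩ _ _ (hs e)
      · have hdep := hJ.insert_dep (e := (e : α)) ⟨⟨e, he, rfl⟩, by simpa using heJ⟩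
        have hc : G.ContainsCycle (insert (e : α) (Subtype.val '' (J : Set E))) := by
          by_contra hc
          exact hdep.not_indep ((hM.2 _ (hM.1 ▸ hdep.subset_ground)).2 hc)
        exact hc.eq_of_insert ((hM.2 _ hJG).1 hJ.indep) hρJ' (hs e)
    rcases isEmpty_or_nonempty E with hE | ⟨⟨e₀⟩⟩
    · simp [Finset.eq_empty_of_isEmpty]
    have hpre (v : V) : ∃ q : E × Bool, v ∈ W → s q = v := by
      by_cases hv : v ∈ W
      · obtain ⟨q, -, hq⟩ := Finset.mem_image.1 hv
        exact ⟨q, fun _ => hq⟩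
      · exact ⟨(e₀, true), fun h => (hv h).elim⟩
    choose t ht using hpre
    have hJ' : (J.map (Function.Embedding.subtype _)).card = J.card := Finset.card_map _
    -- Both ends of `e ∈ S` have the same `ρ`, so one root `t (ρ _)` serves both directions of `e`.
    calc ∑ e ∈ S, x e
        = ∑ e ∈ S, ∑ b, z (t (ρ (s (e, b))), (e, b)) := by
          refine Finset.sum_congr rfl fun e he => ?_
          rw [Fintype.sum_bool, ← hρS e he, h2 (t (ρ (s (e, false)))) e, add_comm]
      _ ≤ ∑ e, ∑ b, z (t (ρ (s (e, b))), (e, b)) :=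
          Finset.sum_le_univ_sum_of_nonneg fun e => Finset.sum_nonneg fun b _ => h0 _
      _ = ∑ a : E × Bool, z (t (ρ (s a)), a) :=
          (Fintype.sum_prod_type fun a => z (t (ρ (s a)), a)).symm
      _ = ∑ v ∈ W, ∑ a with s a = v, z (t (ρ (s a)), a) :=
          (Finset.sum_fiberwise_of_maps_to (fun a _ => hsW a) _).symm
      -- All terms at head `v` use the root `ρ v`, so a representative contributes zero.
      _ ≤ ∑ v ∈ W, if v = ρ v then (0 : ℝ) else 1 := by
          refine Finset.sum_le_sum fun v hv => ?_
          have := h1 (t (ρ v)) (t v)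
          rw [ht v hv, ht _ (hρW v hv)] at this
          refine le_trans (le_of_eq (Finset.sum_congr rfl fun a ha => ?_)) this
          rw [(Finset.mem_filter.1 ha).2]
      _ = W.card - (W.filter fun v => v = ρ v).card := by
          rw [← Finset.card_filter_add_card_filter_not (s := W) (fun v => v = ρ v)]
          simp [Finset.sum_ite]
      _ ≤ J.card := by
          rw [hJ'] at hcard
          rw [sub_le_iff_le_add]
          exact_mod_cast hcard

end Graph

/-! ### Counting inequalities. -/

namespace Matroid

variable {α : Type*} {M : Matroid α} {E : Set α}

lemma IsGraphic.hasExtendedFormulation [Fintype E] (hE : M.E = E) (h : M.IsGraphic) :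
    HasExtendedFormulation (M.indepPolytopeOn E) (8 * Fintype.card E ^ 2) := by
  classical
  obtain ⟨V, G, -, hM⟩ := h
  have hends (e : E) : ∃ u : Bool → V, G.IsLink (e : α) (u false) (u true) := by
    obtain ⟨u, v, huv⟩ := G.exists_isLink_of_mem_edgeSet (e := (e : α))
      (by rw [← hM.1, hE]; exact e.2)
    exact ⟨fun b => if b then v else u, by simpa using huv⟩
  choose s' hs' using hends
  let s : E × Bool → V := fun a => s' a.1 a.2
  have hs (e : E) : G.IsLink (e : α) (s (e, false)) (s (e, true)) := hs' e
  let Z := (E × Bool) × (E × Bool)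
  let proj (i : E ⊕ Z) : (E ⊕ Z → ℝ) →ₗ[ℝ] ℝ := LinearMap.proj i
  -- `Z` has `(2|E|)^2` elements; sign and indegree constraints use one copy each.
  have key := HasExtendedFormulation.of_fintype (σ := E ⊕ Z) (κ := Z ⊕ Z) (μ := (E × Bool) × E)
    (P := M.indepPolytopeOn E)
    (Sum.elim (fun a => -proj (Sum.inr a))
      (fun a => ∑ c with s c = s a.2, proj (Sum.inr (a.1, c))))
    (Sum.elim 0 (fun a => if s a.2 = s a.1 then 0 else 1))
    (fun a => proj (Sum.inl a.2) - proj (Sum.inr (a.1, (a.2, false))) -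
      proj (Sum.inr (a.1, (a.2, true))))
    0 (LinearMap.funLeft ℝ ℝ Sum.inl) (r := 2) ?_ ?_
  · convert key using 1
    simp only [Z, Fintype.card_sum, Fintype.card_prod, Fintype.card_bool]
    ring
  · intro y hf hg
    simp only [Sum.forall, Sum.elim_inl, Sum.elim_inr, LinearMap.neg_apply, proj, LinearMap.proj_apply,
      LinearMap.sum_apply, LinearMap.sub_apply, Pi.zero_apply, neg_nonpos] at hf hg
    have h1 (a : Z) : y (Sum.inr a) ≤ 1 := by
      have h2 := Finset.single_le_sum (f := fun c => y (Sum.inr (a.1, c)))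
        (s := Finset.univ.filter fun c => s c = s a.2) (fun c _ => hf.1 _)
        (Finset.mem_filter.2 ⟨Finset.mem_univ a.2, rfl⟩)
      refine (h2.trans (hf.2 a)).trans ?_
      split_ifs <;> norm_num
    rintro (e | a)
    · have h2 := hg ((e, true), e)
      have h3 := hf.1 ((e, true), (e, false))
      have h4 := hf.1 ((e, true), (e, true))
      have h5 := h1 ((e, true), (e, false))
      have h6 := h1 ((e, true), (e, true))
      exact abs_le.2 ⟨by linarith, by linarith⟩
    · exact abs_le.2 ⟨by linarith [hf.1 a], by linarith [h1 a]⟩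
  · ext x
    rw [Graph.mem_indepPolytopeOn_iff hE hM hs]
    simp only [Sum.forall, Sum.elim_inl, Sum.elim_inr, LinearMap.neg_apply, proj, LinearMap.proj_apply,
      LinearMap.sum_apply, LinearMap.sub_apply, Pi.zero_apply, neg_nonpos]
    constructor
    · rintro ⟨y, ⟨hf, hg⟩, rfl⟩
      refine ⟨fun a => y (Sum.inr a), hf.1, fun p q => ?_, fun p e => ?_⟩
      · convert hf.2 (p, q)
      · have := hg (p, e)
        change y (Sum.inl e) = _
        linarith
    · rintro ⟨z, h0, h1, h2⟩
      refine ⟨Sum.elim x z, ⟨⟨h0, fun a => ?_⟩, fun a => ?_⟩, rfl⟩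
      · convert h1 a.1 a.2
        rfl
      · simp only [Sum.elim_inl, Sum.elim_inr, h2 a.1 a.2]
        ring

lemma IsGraphic.hasExtendedFormulation_dual [Fintype E] (hE : M.E = E) (h : M.IsGraphic) :
    HasExtendedFormulation (M✶.indepPolytopeOn E)
      (8 * Fintype.card E ^ 2 + (Fintype.card E + Fintype.card E)) := by
  classical
  obtain ⟨B, hB⟩ := M.exists_isBase
  have hB' : Subtype.val '' ((Finset.univ.filter fun e : E => (e : α) ∈ B : Finset E) : Set E) =
      B := by
    ext e
    simp only [Finset.coe_filter, Finset.mem_univ, true_and, Set.mem_image, Set.mem_ofPred_eq,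
      Subtype.exists, exists_and_left, exists_prop, exists_eq_right_right]
    exact ⟨fun h => h.1, fun h => ⟨h, hE ▸ hB.subset_ground h⟩⟩
  rw [indepPolytopeOn_dual hE (hB'.symm ▸ hB)]
  exact (h.hasExtendedFormulation hE).below_complement
    (fun y hy => nonneg_of_mem_indepPolytopeOn hy) _

end Matroid

theorem proposition2p2 :
    ∃ C : ℕ, ∀ (α : Type*) (M : Matroid α) [M.Finite], M.IsGraphic ∨ M.IsCographic →
      extensionComplexity M.indepPolytope ≤ ((C * M.E.ncard ^ 2 : ℕ) : ℕ∞) := by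
  -- `8n^2 + 2n ≤ 10n^2` for every natural `n`, including zero.
  refine ⟨10, fun α M _ h => ?_⟩
  have := M.ground_finite.fintype
  have hcard : Fintype.card M.E = M.E.ncard := by
    rw [← Nat.card_eq_fintype_card, Nat.card_coe_set_eq]
  rcases h with h | ⟨N, hN, rfl⟩
  · refine (h.hasExtendedFormulation rfl).extensionComplexity_le.trans ?_
    rw [hcard]
    exact_mod_cast Nat.mul_le_mul_right _ (by norm_num)
  · refine (Matroid.IsGraphic.hasExtendedFormulation_dual (M := N) (E := N.dual.E) rfl hN).extensionComplexity_le.trans ?_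
    rw [hcard]
    have : N.dual.E.ncard ≤ N.dual.E.ncard ^ 2 := Nat.le_self_pow two_ne_zero _
    exact_mod_cast (by omega)
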